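/- Let $\kappa$ be an infinite regular cardinal. Let $\mathfrak{d}_\kappa$ be the least cardinality of a family $A\subseteq{}^{\kappa}\kappa$ such that for every $f\in{}^{\kappa}\kappa$ there is a $g\in A$ with $|\{\alpha<\kappa : g(\alpha)<f(\alpha)\}|<\kappa$. Suppose that $\lambda=\kappa^+=\mathfrak{d}_\kappa$. Then $$\lambda^2\not\longrightarrow(\lambda\kappa,4)^2 ,$$ where the powers and products $\lambda^2$ and $\lambda\kappa$ of the initial ordinals $\lambda,\kappa$ are ordinal ones ($\lambda\kappa$ is the order type of $\kappa$ copies of $\lambda$ placed one after the other). That is, it is not the case that for every colouring of the two-element subsets of the ordinal $\lambda^2$ with the colours $0$ and $1$ there is either a set $X\subseteq\lambda^2$ of order type $\lambda\kappa$ all of whose two-element subsets have colour $0$, or a set $X\subseteq\lambda^2$ of order type $4$ all of whose two-element subsets have colour $1$. Equivalently, there is a graph on the vertex set $\lambda^2$ that contains neither a $4$-clique nor an independent set of order type $\lambda\kappa$. -/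

import Mathlib

universe u

namespace OrdinalPartition

/-- The dominating number `𝔡_κ`: the least cardinality of a family `A` of functions from `κ` to `κ`
such that for every `f : κ → κ` there is a `g ∈ A` with `|{α < κ : g α < f α}| < κ`.
The set of ordinals below (the initial ordinal of) `κ` is represented by `κ.ord.ToType`. -/
noncomputable def dominatingNumber (κ : Cardinal.{u}) : Cardinal.{u} :=
  sInf {c : Cardinal.{u} | ∃ A : Set (κ.ord.ToType → κ.ord.ToType),
    Cardinal.mk A = c ∧
      ∀ f : κ.ord.ToType → κ.ord.ToType, ∃ g ∈ A, Cardinal.mk {a | g a < f a} < κ}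

/-- The ordinary partition relation `α ⟶ (β i : i ∈ ι)^k`: for every colouring `f` of the
`k`-element subsets of `α` with colours in `ι` there are a colour `i` and a set `X ⊆ α` of order
type `β i` all of whose `k`-element subsets get colour `i`. -/
def Arrow {ι : Type*} (α : Ordinal.{u}) (β : ι → Ordinal.{u}) (k : ℕ) : Prop :=
  ∀ f : {s : Finset α.ToType // s.card = k} → ι,
    ∃ (i : ι) (X : Set α.ToType), Ordinal.type (fun x y : X => x < y) = β i ∧
      ∀ s : {s : Finset α.ToType // s.card = k}, (s.1 : Set α.ToType) ⊆ X → f s = i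

end OrdinalPartition

open Set Cardinal

namespace OrdinalPartition

/-! Read λ² as λ columns of height λ. A point (α, β) is joined only to points (c, δ) to its right
with c, δ < β; this neighbourhood is built by recursion on β.

An independent set of type λκ would meet κ columns in λ points each. Let η be the supremum of these
columns and b > η a height below which each still has at least κ of the points. By
`exists_dominating`, one index ν < λ codes bounds saying where such columns and points occur,
measured by ρ(·, η) and ρ(·, b) with ρ from `exists_rho`. A height β > b, ν has at most κ tasks (η,
b, ν) to serve, so they can be treated one by one in κ steps. Serving each task forces an edge
inside the set.

Cliques are controlled by the order of the tasks: inside a neighbourhood, edges lead only to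
strictly earlier tasks (`exists_heights`), while columns of later tasks have larger ρ-values
(`exists_columns`). For a 4-clique x, y, a, b, the resulting inequalities in the neighbourhoods of x
and y contradict the ultrametric inequalities of ρ. -/

/-- The ordinals below the initial ordinal of the cardinal `c`. -/
abbrev Below (c : Cardinal.{u}) : Type u := c.ord.ToType

/-! ### Recursion and cardinal arithmetic at a regular cardinal -/

/-- A recursion principle for choosing values one after the other along a well-founded relation,
where the requirement on a value depends only on the values chosen before. -/
theorem exists_forall_of_wellFoundedLT {ι : Type*} {γ : Type*} [LinearOrder ι] [WellFoundedLT ι]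
    [Nonempty γ] (R : ι → (ι → γ) → γ → Prop)
    (hloc : ∀ i f g z, (∀ j < i, f j = g j) → R i f z → R i g z)
    (hex : ∀ i f, (∀ j < i, R j f (f j)) → ∃ z, R i f z) :
    ∃ f : ι → γ, ∀ i, R i f (f i) := by
  classical
  let ext : (i : ι) → ((j : ι) → j < i → γ) → ι → γ := fun i g j =>
    if h : j < i then g j h else Classical.arbitrary γ
  let F : (i : ι) → ((j : ι) → j < i → γ) → γ := fun i g =>
    Classical.epsilon (R i (ext i g))
  let f : ι → γ := (wellFounded_lt (α := ι)).fix F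
  have hf : ∀ i, f i = F i (fun j _ => f j) := fun i => WellFounded.fix_eq _ _ _
  have hext : ∀ i, ∀ j < i, ext i (fun j _ => f j) j = f j := fun i j h => by simp [ext, h]
  refine ⟨f, fun i => ?_⟩
  induction i using WellFoundedLT.induction with
  | ind i ih =>
    obtain ⟨z, hz⟩ := hex i f ih
    have h1 : R i (ext i fun j _ => f j) z := hloc i _ _ _ (fun j h => (hext i j h).symm) hz
    rw [hf]
    exact hloc i _ _ _ (hext i) (Classical.epsilon_spec ⟨z, h1⟩)

theorem mk_Iio_below_lt {c : Cardinal.{u}} (i : Below c) : #(Iio i) < c := by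
  simpa using Cardinal.mk_Iio_lt i (by simp)

theorem mk_Iic_lt {c : Cardinal.{u}} (hc : c.IsRegular) (i : Below c) : #(Iic i) < c := by
  have : Iic i = insert i (Iio i) := by ext x; simp [le_iff_eq_or_lt]
  rw [this]
  refine (mk_insert_le).trans_lt ?_
  exact add_lt_of_lt hc.aleph0_le (mk_Iio_below_lt i) (one_lt_aleph0.trans_le hc.aleph0_le)

theorem exists_gt_of_mk_lt {c : Cardinal.{u}} (hc : c.IsRegular) (s : Set (Below c))
    (hs : #s < c) : ∃ b, ∀ a ∈ s, a < b := by
  by_contra! h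
  have h1 : IsCofinal s := fun b => (h b)
  have h2 := Order.cof_le h1
  rw [Ordinal.cof_toType, hc.cof_ord] at h2
  exact absurd hs h2.not_gt

theorem mk_biUnion_lt {κ : Cardinal.{u}} (hκ : κ.IsRegular) {α β : Type u} {s : Set α}
    {t : α → Set β} (hs : #s < κ) (ht : ∀ a ∈ s, #(t a) < κ) : #(⋃ a ∈ s, t a : Set β) < κ :=
  (card_biUnion_lt_iff_forall_of_isRegular (t := fun a _ => t a) hκ hs).2 ht

theorem mk_union_lt {κ : Cardinal.{u}} (hκ : κ.IsRegular) {α : Type u} {s t : Set α}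
    (hs : #s < κ) (ht : #t < κ) : #(s ∪ t : Set α) < κ :=
  (mk_union_le s t).trans_lt (add_lt_of_lt hκ.aleph0_le hs ht)

theorem mk_Iio_succ_le {κ : Cardinal.{u}} (b : Below (Order.succ κ)) : #(Iio b) ≤ κ :=
  Order.lt_succ_iff.1 (mk_Iio_below_lt b)

theorem exists_injOn {κ : Cardinal.{u}} {α : Type u} (hκ : κ ≠ 0) (s : Set α) (hs : #s ≤ κ) :
    ∃ f : α → Below κ, InjOn f s := by
  classical
  rw [← mk_ord_toType κ] at hs
  obtain ⟨e⟩ := hs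
  have : Nonempty (Below κ) := by
    rw [Ordinal.nonempty_toType_iff]; simpa using hκ
  refine ⟨fun a => if h : a ∈ s then e ⟨a, h⟩ else Classical.arbitrary _, ?_⟩
  intro a ha b hb h
  simpa [ha, hb] using h

/-! ### The ultrametric function ρ -/

/-- A function `ρ` on the pairs below `κ⁺` with values below `κ` that satisfies two ultrametric
inequalities and takes small values at few points only. -/
theorem exists_rho {κ : Cardinal.{u}} (hκ : κ.IsRegular) :
    ∃ ρ : Below (Order.succ κ) → Below (Order.succ κ) → Below κ,
      (∀ a b c, a < b → b < c → ρ a c ≤ max (ρ a b) (ρ b c)) ∧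
      (∀ a b c, a < b → b < c → ρ a b ≤ max (ρ a c) (ρ b c)) ∧
      ∀ b ν, #{a | a < b ∧ ρ a b ≤ ν} < κ := by
  classical
  have hne : Nonempty (Below κ) := by
    rw [Ordinal.nonempty_toType_iff]; simpa using hκ.pos.ne'
  obtain ⟨f, hf⟩ := exists_forall_of_wellFoundedLT
    (ι := Below (Order.succ κ)) (γ := Below (Order.succ κ) → Below κ)
    (fun c f z =>
      (∀ a b, a < b → b < c → z a ≤ max (f b a) (z b)) ∧
      (∀ a b, a < b → b < c → f b a ≤ max (z a) (z b)) ∧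
      ∀ ν, #{a | a < c ∧ z a ≤ ν} < κ)
    (by
      rintro c f g z hfg ⟨h1, h2, h3⟩
      refine ⟨fun a b hab hbc => ?_, fun a b hab hbc => ?_, h3⟩
      · rw [← hfg b hbc]; exact h1 a b hab hbc
      · rw [← hfg b hbc]; exact h2 a b hab hbc)
    (by
      intro c f ih
      obtain ⟨idx, hidx⟩ := exists_injOn hκ.pos.ne' (Iio c) (mk_Iio_succ_le c)
      -- Below `c`, the two inequalities say that `le ν` is a tree order: it is transitive, and two
      -- predecessors of a point are comparable.
      let le : Below κ → Below (Order.succ κ) → Below (Order.succ κ) → Prop :=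
        fun ν a b => a = b ∨ a < b ∧ f b a ≤ ν
      have le_mono : ∀ {ν μ a b}, ν ≤ μ → le ν a b → le μ a b := by
        rintro ν μ a b h (h1 | ⟨h1, h2⟩)
        · exact Or.inl h1
        · exact Or.inr ⟨h1, h2.trans h⟩
      have le_trans' : ∀ {ν a b d}, d < c → le ν a b → le ν b d → le ν a d := by
        rintro ν a b d hd (rfl | ⟨h1, h2⟩) h3
        · exact h3
        rcases h3 with rfl | ⟨h3, h4⟩
        · exact Or.inr ⟨h1, h2⟩
        · exact Or.inr ⟨h1.trans h3, ((ih d hd).1 a b h1 h3).trans (max_le h2 h4)⟩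
      -- `A ν` is a `le ν`-chain closed downwards: its generators `b` are admitted only once all
      -- points of index at most `idx b` are pairwise comparable. The new value `z a` will be the
      -- least ν with `a ∈ A ν`.
      let A : Below κ → Set (Below (Order.succ κ)) := fun ν =>
        {a | ∃ b < c, idx b ≤ ν ∧ le ν a b ∧ ∀ d < c, ∀ d' < c, idx d ≤ idx b → idx d' ≤ idx b →
          le ν d d' ∨ le ν d' d}
      have A_mono : ∀ {ν μ}, ν ≤ μ → A ν ⊆ A μ := by
        rintro ν μ h a ⟨b, hb, h1, h2, h3⟩
        exact ⟨b, hb, h1.trans h, le_mono h h2, fun d hd d' hd' e e' =>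
          (h3 d hd d' hd' e e').imp (le_mono h) (le_mono h)⟩
      have idx_small : ∀ ν, #{b | b < c ∧ idx b ≤ ν} < κ := by
        intro ν
        refine (mk_le_of_injective (β := Iic ν) (f := fun b => ⟨idx b.1, b.2.2⟩) ?_).trans_lt
          (mk_Iic_lt hκ ν)
        intro a b h
        exact Subtype.ext (hidx a.2.1 b.2.1 (congrArg Subtype.val h))
      have A_ex : ∀ a < c, ∃ ν, a ∈ A ν := by
        intro a ha
        obtain ⟨μ, hμ⟩ := exists_gt_of_mk_lt hκ
          (⋃ d ∈ {b | b < c ∧ idx b ≤ idx a}, ⋃ d' ∈ {b | b < c ∧ idx b ≤ idx a}, {f d d'})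
          (mk_biUnion_lt hκ (idx_small _) fun d _ => mk_biUnion_lt hκ (idx_small _) fun d' _ => by
            simpa using hκ.nat_lt 1)
        have key : ∀ d < c, ∀ d' < c, idx d ≤ idx a → idx d' ≤ idx a → f d d' ≤ μ := by
          intro d hd d' hd' e e'
          refine (hμ _ ?_).le
          simp only [mem_iUnion]
          exact ⟨d, ⟨hd, e⟩, d', ⟨hd', e'⟩, rfl⟩
        refine ⟨max (idx a) μ, a, ha, le_max_left _ _, Or.inl rfl, fun d hd d' hd' e e' => ?_⟩
        rcases lt_trichotomy d d' with h | h | h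
        · exact Or.inl (Or.inr ⟨h, (key _ hd' _ hd e' e).trans (le_max_right _ _)⟩)
        · exact Or.inl (Or.inl h)
        · exact Or.inr (Or.inr ⟨h, (key _ hd _ hd' e e').trans (le_max_right _ _)⟩)
      have hz : ∀ a, ∃ m, a < c → ∀ ν, m ≤ ν ↔ a ∈ A ν := by
        intro a
        by_cases ha : a < c
        · obtain ⟨m, hm, hm'⟩ := (wellFounded_lt (α := Below κ)).has_min {ν | a ∈ A ν} (A_ex a ha)
          exact ⟨m, fun _ ν => ⟨fun h => A_mono h hm, fun h => not_lt.1 (hm' ν h)⟩⟩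
        · exact ⟨Classical.arbitrary _, fun h => absurd h ha⟩
      choose z hz using hz
      refine ⟨z, fun a b hab hbc => ?_, fun a b hab hbc => ?_, fun ν => ?_⟩
      · rw [hz a (hab.trans hbc)]
        obtain ⟨d, hd, h1, h2, h3⟩ := (hz b hbc (max (f b a) (z b))).1 (le_max_right _ _)
        exact ⟨d, hd, h1, le_trans' hd (Or.inr ⟨hab, le_max_left _ _⟩) h2, h3⟩
      · set ν := max (z a) (z b)
        obtain ⟨d, hd, h1, h2, h3⟩ := (hz a (hab.trans hbc) ν).1 (le_max_left _ _)
        obtain ⟨d', hd', h1', h2', h3'⟩ := (hz b hbc ν).1 (le_max_right _ _)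
        have fin : ∀ e < c, le ν a e → le ν b e → f b a ≤ ν := by
          rintro e he (rfl | ⟨p1, p2⟩) q
          · rcases q with rfl | ⟨q1, -⟩
            · exact absurd hab (lt_irrefl _)
            · exact absurd (hab.trans q1) (lt_irrefl _)
          · rcases q with rfl | ⟨q1, q2⟩
            · exact p2
            · exact ((ih e he).2.1 a b hab q1).trans (max_le p2 q2)
        have comp : le ν d d' ∨ le ν d' d := by
          rcases le_total (idx d) (idx d') with h | h
          · exact h3' d hd d' hd' h le_rfl
          · exact h3 d hd d' hd' le_rfl h
        rcases comp with h | h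
        · exact fin d' hd' (le_trans' hd' h2 h) h2'
        · exact fin d hd h2 (le_trans' hd h2' h)
      · refine (mk_le_mk_of_subset (t := ⋃ b ∈ {b | b < c ∧ idx b ≤ ν}, {a | le ν a b}) ?_).trans_lt
          (mk_biUnion_lt hκ (idx_small _) fun b hb => ?_)
        · rintro a ⟨ha, haν⟩
          obtain ⟨d, hd, h1, h2, -⟩ := (hz a ha ν).1 haν
          simp only [mem_iUnion]
          exact ⟨d, ⟨hd, h1⟩, h2⟩
        · have : {a | le ν a b} = {b} ∪ {a | a < b ∧ f b a ≤ ν} := by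
            ext a; simp [le]
          rw [this]
          exact mk_union_lt hκ (by simpa using hκ.nat_lt 1) ((ih b hb.1).2.2 ν))
  exact ⟨fun a b => f b a, fun a b c hab hbc => (hf c).1 a b hab hbc,
    fun a b c hab hbc => (hf c).2.1 a b hab hbc, fun b ν => (hf b).2.2 ν⟩

/-! ### Everywhere domination -/

/-- An injection of b × κ into κ transfers the dominating family to functions of two variables. The
fewer than κ exceptional values are bounded by regularity, so taking the maximum with a constant
gives domination everywhere; ν codes the pair of a family member and a constant. -/
theorem exists_dominating {κ : Cardinal.{u}} (hκ : κ.IsRegular)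
    (hd : Order.succ κ = dominatingNumber κ) :
    ∃ G : Below (Order.succ κ) → Below (Order.succ κ) → Below (Order.succ κ) → Below κ → Below κ,
      ∀ (b : Below (Order.succ κ)) (f : Below (Order.succ κ) → Below κ → Below κ),
        ∃ ν, ∀ c < b, ∀ ε, f c ε ≤ G b ν c ε := by
  classical
  obtain ⟨A, hA, hdom⟩ : Order.succ κ ∈ {c : Cardinal.{u} |
      ∃ A : Set (κ.ord.ToType → κ.ord.ToType), Cardinal.mk A = c ∧
        ∀ f : κ.ord.ToType → κ.ord.ToType, ∃ g ∈ A, Cardinal.mk {a | g a < f a} < κ} := by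
    rw [hd]
    refine csInf_mem (nonempty_iff_ne_empty.2 fun h => ?_)
    rw [dominatingNumber, h, Cardinal.sInf_empty] at hd
    exact (Order.succ_ne_bot κ) hd
  have hκ' := hκ.aleph0_le
  have hcard : #(Below (Order.succ κ)) = #(A × Below κ) := by
    rw [mk_prod, hA, lift_id, lift_id, mk_ord_toType, mk_ord_toType]
    exact (mul_eq_left (hκ'.trans (Order.le_succ κ)) (Order.le_succ κ) hκ.pos.ne').symm
  obtain ⟨j⟩ := Cardinal.eq.1 hcard
  have hidx : ∀ b : Below (Order.succ κ), ∃ f : Below (Order.succ κ) × Below κ → Below κ,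
      InjOn f (Iio b ×ˢ Set.univ) := by
    intro b
    refine exists_injOn hκ.pos.ne' _ ?_
    rw [mk_setProd, mk_univ, mk_ord_toType]
    exact mul_le_of_le hκ' (mk_Iio_succ_le b) le_rfl
  choose idx hidx using hidx
  have hne : Nonempty (Below κ) := by
    rw [Ordinal.nonempty_toType_iff]; simpa using hκ.pos.ne'
  have hneL : Nonempty (Below (Order.succ κ)) := by
    rw [Ordinal.nonempty_toType_iff]; simp
  refine ⟨fun b ν c ε => max ((j ν).1.1 (idx b (c, ε))) (j ν).2, fun b f => ?_⟩
  obtain ⟨g, hg, hsmall⟩ := hdom fun k =>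
    Function.uncurry f (Function.invFunOn (idx b) (Iio b ×ˢ Set.univ) k)
  set F : Below κ → Below κ := fun k =>
    Function.uncurry f (Function.invFunOn (idx b) (Iio b ×ˢ Set.univ) k) with hF
  obtain ⟨e, he⟩ := exists_gt_of_mk_lt hκ (F '' {a | g a < F a}) (mk_image_le.trans_lt hsmall)
  refine ⟨j.symm (⟨g, hg⟩, e), fun c hc ε => ?_⟩
  have hFv : F (idx b (c, ε)) = f c ε := by
    simp only [hF]
    rw [(hidx b).leftInvOn_invFunOn (show (c, ε) ∈ Iio b ×ˢ Set.univ from ⟨hc, trivial⟩)]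
    rfl
  simp only [Equiv.apply_symm_apply, le_max_iff]
  by_cases h : g (idx b (c, ε)) < F (idx b (c, ε))
  · right
    rw [← hFv]
    exact (he _ ⟨_, h, rfl⟩).le
  · left
    rw [← hFv]
    exact not_lt.1 h

/-! ### Construction of the neighbourhoods -/

/-- Selection of columns: the `i`-th task has its limit at `η i` and asks for all the columns
`c < η i` above some `ζ` with `ρ c (η i) ≤ h i ζ`. -/
theorem exists_columns {κ : Cardinal.{u}} (hκ : κ.IsRegular)
    {ρ : Below (Order.succ κ) → Below (Order.succ κ) → Below κ}
    (hρ : ∀ b ν, #{a | a < b ∧ ρ a b ≤ ν} < κ)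
    (η : Below κ → Below (Order.succ κ)) (h : Below κ → Below (Order.succ κ) → Below κ)
    (α β : Below (Order.succ κ)) :
    ∃ C : Below κ → Set (Below (Order.succ κ)), (∀ i, #(C i) < κ) ∧
      (∀ i, ∀ c ∈ C i, α < c ∧ c < β ∧ ρ α β < ρ c β) ∧
      (∀ i, ∀ j < i, ∀ c ∈ C i, ∀ d ∈ C j, ρ d β < ρ c β) ∧
      (∀ i, ∀ j < i, ∀ k < i, ∀ c ∈ C i, ∀ q ∈ C j, ∀ r ∈ C k, c < q → ρ q r < ρ c q) ∧
      ∀ i, α < η i → η i < β →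
        (∀ W : Set (Below (Order.succ κ)), #W < κ → (∀ w ∈ W, w < η i) →
          ∃ ζ < η i, ∀ w ∈ W, w < ζ) →
        ∃ ζ < η i, ∀ c, ζ ≤ c → c < η i → ρ c (η i) ≤ h i ζ → c ∈ C i := by
  classical
  obtain ⟨C, hC⟩ := exists_forall_of_wellFoundedLT (ι := Below κ)
    (γ := Set (Below (Order.succ κ)))
    (fun i C z => #z < κ ∧
      (∀ c ∈ z, α < c ∧ c < β ∧ ρ α β < ρ c β) ∧
      (∀ j < i, ∀ c ∈ z, ∀ d ∈ C j, ρ d β < ρ c β) ∧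
      (∀ j < i, ∀ k < i, ∀ c ∈ z, ∀ q ∈ C j, ∀ r ∈ C k, c < q → ρ q r < ρ c q) ∧
      (α < η i → η i < β →
        (∀ W : Set (Below (Order.succ κ)), #W < κ → (∀ w ∈ W, w < η i) →
          ∃ ζ < η i, ∀ w ∈ W, w < ζ) →
        ∃ ζ < η i, ∀ c, ζ ≤ c → c < η i → ρ c (η i) ≤ h i ζ → c ∈ z))
    (by
      rintro i f g z hfg ⟨h0, h1, h2, h3, h4⟩
      refine ⟨h0, h1, fun j hj => ?_, fun j hj k hk => ?_, h4⟩
      · rw [← hfg j hj]; exact h2 j hj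
      · rw [← hfg j hj, ← hfg k hk]; exact h3 j hj k hk)
    (by
      intro i C ih
      by_cases hact : α < η i ∧ η i < β ∧
        (∀ W : Set (Below (Order.succ κ)), #W < κ → (∀ w ∈ W, w < η i) →
          ∃ ζ < η i, ∀ w ∈ W, w < ζ)
      swap
      · refine ⟨∅, by simpa using hκ.pos, by simp, by simp, by simp, fun a b c => ?_⟩
        exact absurd ⟨a, b, c⟩ hact
      obtain ⟨hα, hβ, hcof⟩ := hact
      set Q : Set (Below (Order.succ κ)) := ⋃ j ∈ Iio i, C j with hQ
      have hQs : #Q < κ := mk_biUnion_lt hκ (mk_Iio_below_lt i) fun j hj => (ih j hj).1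
      have hCQ : ∀ j < i, ∀ q ∈ C j, q ∈ Q := fun j hj q hq => by
        simp only [hQ, mem_iUnion]; exact ⟨j, hj, hq⟩
      have h1s : ∀ x : Below (Order.succ κ), #({x} : Set (Below (Order.succ κ))) < κ := fun x => by
        simpa using hκ.nat_lt 1
      -- The columns that would violate an inequality against α or an earlier task. There are fewer
      -- than κ of them, so those below `η i` are bounded below `η i`.
      set W : Set (Below (Order.succ κ)) := ({α} ∪ {c | c < β ∧ ρ c β ≤ ρ α β}) ∪
        ((⋃ q ∈ Q, {c | c < β ∧ ρ c β ≤ ρ q β}) ∪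
          ⋃ q ∈ Q, ⋃ r ∈ Q, {c | c < q ∧ ρ c q ≤ ρ q r}) with hW
      have hWs : #W < κ :=
        mk_union_lt hκ (mk_union_lt hκ (h1s α) (hρ _ _)) <| mk_union_lt hκ
          (mk_biUnion_lt hκ hQs fun q _ => hρ _ _)
          (mk_biUnion_lt hκ hQs fun q _ => mk_biUnion_lt hκ hQs fun r _ => hρ _ _)
      obtain ⟨ζ, hζ, hζW⟩ := hcof (W ∩ Iio (η i))
        ((mk_le_mk_of_subset inter_subset_left).trans_lt hWs) fun w hw => hw.2
      have hnot : ∀ c, ζ ≤ c → c < η i → c ∉ W := fun c h1 h2 hc =>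
        absurd (hζW c ⟨hc, h2⟩) h1.not_gt
      have hαζ : α < ζ := hζW α ⟨Or.inl (Or.inl rfl), hα⟩
      refine ⟨{c | ζ ≤ c ∧ c < η i ∧ ρ c (η i) ≤ h i ζ}, ?_, ?_, ?_, ?_, ?_⟩
      · exact (mk_le_mk_of_subset fun c hc => hc.2).trans_lt (hρ (η i) (h i ζ))
      · rintro c ⟨h1, h2, -⟩
        refine ⟨hαζ.trans_le h1, h2.trans hβ, not_le.1 fun hle => hnot c h1 h2 ?_⟩
        exact Or.inl (Or.inr ⟨h2.trans hβ, hle⟩)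
      · rintro j hj c ⟨h1, h2, -⟩ d hd
        refine not_le.1 fun hle => hnot c h1 h2 (Or.inr (Or.inl ?_))
        simp only [mem_iUnion]
        exact ⟨d, hCQ j hj d hd, h2.trans hβ, hle⟩
      · rintro j hj k hk c ⟨h1, h2, -⟩ q hq r hr hcq
        refine not_le.1 fun hle => hnot c h1 h2 (Or.inr (Or.inr ?_))
        simp only [mem_iUnion]
        exact ⟨q, hCQ j hj q hq, r, hCQ k hk r hr, hcq, hle⟩
      · exact fun _ _ _ => ⟨ζ, hζ, fun c h1 h2 h3 => ⟨h1, h2, h3⟩⟩)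
  exact ⟨C, fun i => (hC i).1, fun i => (hC i).2.1, fun i => (hC i).2.2.1, fun i => (hC i).2.2.2.1,
    fun i => (hC i).2.2.2.2⟩

/-- Selection of heights: in each of the selected columns, few points are chosen so that there are
no edges from a chosen point to another one that belongs to the same or to a later task. -/
theorem exists_heights {κ : Cardinal.{u}} (hκ : κ.IsRegular)
    {ρ : Below (Order.succ κ) → Below (Order.succ κ) → Below κ}
    (hρ : ∀ b ν, #{a | a < b ∧ ρ a b ≤ ν} < κ)
    (β : Below (Order.succ κ))
    (E : Below (Order.succ κ) → Below (Order.succ κ) → Set (Below (Order.succ κ) ×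
      Below (Order.succ κ)))
    (hE : ∀ γ, ∀ δ < β, ∀ q ∈ E γ δ, γ < q.1)
    (hEs : ∀ γ, ∀ δ < β, ∀ c, #{δ' | (c, δ') ∈ E γ δ} < κ)
    (C : Below κ → Set (Below (Order.succ κ)))
    (hCs : ∀ i, #(C i) < κ)
    (hC : ∀ i, ∀ j < i, ∀ c ∈ C i, c ∉ C j)
    (b : Below κ → Below (Order.succ κ))
    (g : Below κ → Below (Order.succ κ) → Below κ → Below κ) :
    ∃ M : Set (Below (Order.succ κ) × Below (Order.succ κ)),
      (∀ p ∈ M, p.2 < β ∧ ∃ i, p.1 ∈ C i) ∧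
      (∀ p ∈ M, ∀ q ∈ M, q ∈ E p.1 p.2 → ∀ i j, p.1 ∈ C i → q.1 ∈ C j → j < i) ∧
      (∀ c, #{δ | (c, δ) ∈ M} < κ) ∧
      ∀ i, b i < β → ∀ c ∈ C i, ∃ ε, ∀ δ < b i, ε < ρ δ (b i) → ρ δ (b i) ≤ g i c ε →
        (c, δ) ∈ M := by
  classical
  obtain ⟨D, hD⟩ := exists_forall_of_wellFoundedLT (ι := Below (Order.succ κ))
    (γ := Set (Below (Order.succ κ)))
    (fun c D z => #z < κ ∧ (∀ δ ∈ z, δ < β ∧ ∃ i, c ∈ C i) ∧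
      (∀ c' < c, ∀ i, c ∈ C i → ∀ j ≤ i, c' ∈ C j → ∀ δ' ∈ D c', δ' < β → ∀ δ ∈ z,
        (c, δ) ∉ E c' δ') ∧
      ∀ i, b i < β → c ∈ C i → ∃ ε, ∀ δ < b i, ε < ρ δ (b i) → ρ δ (b i) ≤ g i c ε → δ ∈ z)
    (by
      rintro c f f' z hf ⟨h1, h2, h3, h4⟩
      refine ⟨h1, h2, fun c' hc' => ?_, h4⟩
      rw [← hf c' hc']
      exact h3 c' hc')
    (by
      intro c D ih
      by_cases hc : ∃ i, b i < β ∧ c ∈ C i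
      swap
      · exact ⟨∅, by simpa using hκ.pos, by simp, by simp,
          fun i h1 h2 => absurd ⟨i, h1, h2⟩ hc⟩
      obtain ⟨i, hb, hci⟩ := hc
      have huniq : ∀ j, c ∈ C j → j = i := by
        intro j hj
        rcases lt_trichotomy j i with h | h | h
        · exact absurd hj (hC i j h c hci)
        · exact h
        · exact absurd hci (hC j i h c hj)
      -- The forbidden heights in column `c`: those reached by an edge from a point already chosen
      -- in a smaller column of the same or an earlier task. Choosing ε above their ρ-values avoids
      -- all of them.
      set X : Set (Below (Order.succ κ)) :=
        ⋃ c' ∈ (⋃ j ∈ Iic i, C j) ∩ Iio c, ⋃ δ' ∈ D c' ∩ Iio β,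
          {δ | (c, δ) ∈ E c' δ'} with hX
      have hXs : #X < κ :=
        mk_biUnion_lt hκ ((mk_le_mk_of_subset inter_subset_left).trans_lt
          (mk_biUnion_lt hκ (mk_Iic_lt hκ i) fun j _ => hCs j)) fun c' hc' =>
          mk_biUnion_lt hκ ((mk_le_mk_of_subset inter_subset_left).trans_lt (ih c' hc'.2).1)
            fun δ' hδ' => hEs c' δ' hδ'.2 c
      obtain ⟨ε, hε⟩ := exists_gt_of_mk_lt hκ ((fun δ => ρ δ (b i)) '' X)
        (mk_image_le.trans_lt hXs)
      refine ⟨{δ | δ < b i ∧ ε < ρ δ (b i) ∧ ρ δ (b i) ≤ g i c ε}, ?_, ?_, ?_, ?_⟩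
      · refine (mk_le_mk_of_subset ?_).trans_lt (hρ (b i) (g i c ε))
        exact fun δ hδ => ⟨hδ.1, hδ.2.2⟩
      · exact fun δ hδ => ⟨hδ.1.trans hb, i, hci⟩
      · intro c' hc' i' hi' j hj hc'j δ' hδ' hδ'β δ hδ hmem
        rw [huniq i' hi'] at hj
        refine lt_asymm hδ.2.1 (hε _ ⟨δ, ?_, rfl⟩)
        have hc'' : c' ∈ ⋃ j ∈ Iic i, C j := by
          simp only [mem_iUnion]; exact ⟨j, hj, hc'j⟩
        simp only [hX, mem_iUnion]
        exact ⟨c', ⟨hc'', hc'⟩, δ', ⟨hδ', hδ'β⟩, hmem⟩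
      · intro j _ hj
        obtain rfl := huniq j hj
        exact ⟨ε, fun δ h1 h2 h3 => ⟨h1, h2, h3⟩⟩)
  refine ⟨{p | p.2 ∈ D p.1}, fun p hp => (hD p.1).2.1 p.2 hp, ?_, fun c => (hD c).1,
    fun i hi c hc => (hD c).2.2.2 i hi hc⟩
  intro p hp q hq hpq i j hi hj
  have hpβ := ((hD p.1).2.1 p.2 hp).1
  refine not_le.1 fun hle => ?_
  exact (hD q.1).2.2.1 p.1 (hE p.1 p.2 hpβ q hpq) j hj i hle hi p.2 hp hpβ q.2 hq hpq

/-- The set `N α β` of the neighbours of the point `(α, β)` to the right of its column. -/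
theorem exists_neighbours {κ : Cardinal.{u}} (hκ : κ.IsRegular)
    {ρ : Below (Order.succ κ) → Below (Order.succ κ) → Below κ}
    (hρ : ∀ b ν, #{a | a < b ∧ ρ a b ≤ ν} < κ)
    (G : Below (Order.succ κ) → Below (Order.succ κ) → Below (Order.succ κ) → Below κ → Below κ)
    (e₀ : Below κ) :
    ∃ N : Below (Order.succ κ) → Below (Order.succ κ) →
        Set (Below (Order.succ κ) × Below (Order.succ κ)),
      (∀ α β, ∀ p ∈ N α β, α < p.1 ∧ p.1 < β ∧ p.2 < β ∧ ρ α β < ρ p.1 β) ∧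
      (∀ α β, ∀ p ∈ N α β, ∀ q ∈ N α β, q ∈ N p.1 p.2 → ρ q.1 β < ρ p.1 β) ∧
      (∀ α β, ∀ p ∈ N α β, ∀ q ∈ N α β, ∀ r ∈ N α β, q ∈ N p.1 p.2 → r ∈ N q.1 q.2 →
        ρ q.1 r.1 < ρ p.1 q.1) ∧
      ∀ α β η b ν, α < η → η < β → b < β → ν < β →
        (∀ W : Set (Below (Order.succ κ)), #W < κ → (∀ w ∈ W, w < η) → ∃ ζ < η, ∀ w ∈ W, w < ζ) →
        ∃ ζ < η, ∀ c, ζ ≤ c → c < η → ρ c η ≤ G b ν ζ e₀ →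
          ∃ ε, ∀ δ < b, ε < ρ δ b → ρ δ b ≤ G b ν c ε → (c, δ) ∈ N α β := by
  classical
  obtain ⟨N, hN⟩ := exists_forall_of_wellFoundedLT (ι := Below (Order.succ κ))
    (γ := Below (Order.succ κ) → Set (Below (Order.succ κ) × Below (Order.succ κ)))
    (fun β N z => ∀ α,
      (∀ p ∈ z α, α < p.1 ∧ p.1 < β ∧ p.2 < β ∧ ρ α β < ρ p.1 β) ∧
      (∀ p ∈ z α, ∀ q ∈ z α, p.2 < β → q ∈ N p.2 p.1 → ρ q.1 β < ρ p.1 β) ∧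
      (∀ p ∈ z α, ∀ q ∈ z α, ∀ r ∈ z α, p.2 < β → q.2 < β → q ∈ N p.2 p.1 → r ∈ N q.2 q.1 →
        ρ q.1 r.1 < ρ p.1 q.1) ∧
      (∀ c, #{δ | (c, δ) ∈ z α} < κ) ∧
      ∀ η b ν, α < η → η < β → b < β → ν < β →
        (∀ W : Set (Below (Order.succ κ)), #W < κ → (∀ w ∈ W, w < η) → ∃ ζ < η, ∀ w ∈ W, w < ζ) →
        ∃ ζ < η, ∀ c, ζ ≤ c → c < η → ρ c η ≤ G b ν ζ e₀ →
          ∃ ε, ∀ δ < b, ε < ρ δ b → ρ δ b ≤ G b ν c ε → (c, δ) ∈ z α)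
    (by
      intro β f f' z hf h α
      obtain ⟨h1, h2, h3, h4⟩ := h α
      refine ⟨h1, fun p hp q hq hpβ => ?_, fun p hp q hq r hr hpβ hqβ => ?_, h4⟩
      · rw [← hf p.2 hpβ]
        exact h2 p hp q hq hpβ
      · rw [← hf p.2 hpβ, ← hf q.2 hqβ]
        exact h3 p hp q hq r hr hpβ hqβ)
    (by
      intro β f ih
      suffices h : ∀ α, ∃ s : Set (Below (Order.succ κ) × Below (Order.succ κ)),
        (∀ p ∈ s, α < p.1 ∧ p.1 < β ∧ p.2 < β ∧ ρ α β < ρ p.1 β) ∧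
        (∀ p ∈ s, ∀ q ∈ s, p.2 < β → q ∈ f p.2 p.1 → ρ q.1 β < ρ p.1 β) ∧
        (∀ p ∈ s, ∀ q ∈ s, ∀ r ∈ s, p.2 < β → q.2 < β → q ∈ f p.2 p.1 → r ∈ f q.2 q.1 →
          ρ q.1 r.1 < ρ p.1 q.1) ∧
        (∀ c, #{δ | (c, δ) ∈ s} < κ) ∧
        ∀ η b ν, α < η → η < β → b < β → ν < β →
          (∀ W : Set (Below (Order.succ κ)), #W < κ → (∀ w ∈ W, w < η) →
            ∃ ζ < η, ∀ w ∈ W, w < ζ) →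
          ∃ ζ < η, ∀ c, ζ ≤ c → c < η → ρ c η ≤ G b ν ζ e₀ →
            ∃ ε, ∀ δ < b, ε < ρ δ b → ρ δ b ≤ G b ν c ε → (c, δ) ∈ s by
        choose z hz using h
        exact ⟨z, hz⟩
      intro α
      obtain ⟨idx, hidx⟩ := exists_injOn hκ.pos.ne' (Iio β ×ˢ (Iio β ×ˢ Iio β)) (by
        simp only [mk_setProd]
        exact mul_le_of_le hκ.aleph0_le (mk_Iio_succ_le β)
          (mul_le_of_le hκ.aleph0_le (mk_Iio_succ_le β) (mk_Iio_succ_le β)))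
      -- The inverse `t` of the injection lists all tasks (η, b, ν) below β in type κ, so fewer than
      -- κ tasks precede each one.
      have : Nonempty (Below (Order.succ κ)) := ⟨α⟩
      set t := Function.invFunOn idx (Iio β ×ˢ (Iio β ×ˢ Iio β)) with ht
      obtain ⟨C, hC0, hC1, hC2, hC3, hC4⟩ := exists_columns hκ hρ (fun i => (t i).1)
        (fun i ζ => G (t i).2.1 (t i).2.2 ζ e₀) α β
      obtain ⟨M, hM1, hM2, hM3, hM4⟩ := exists_heights hκ hρ β (fun γ δ => f δ γ)
        (fun γ δ hδ q hq => ((ih δ hδ γ).1 q hq).1) (fun γ δ hδ => (ih δ hδ γ).2.2.2.1) C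
        hC0 (fun i j hj c hc hc' => lt_irrefl _ (hC2 i j hj c hc c hc'))
        (fun i => (t i).2.1) (fun i => G (t i).2.1 (t i).2.2)
      refine ⟨M, ?_, fun p hp q hq _ hpq => ?_, ?_, hM3, ?_⟩
      · intro p hp
        obtain ⟨h1, i, hi⟩ := hM1 p hp
        obtain ⟨h2, h3, h4⟩ := hC1 i _ hi
        exact ⟨h2, h3, h1, h4⟩
      · obtain ⟨-, i, hi⟩ := hM1 p hp
        obtain ⟨-, j, hj⟩ := hM1 q hq
        exact hC2 i j (hM2 p hp q hq hpq i j hi hj) _ hi _ hj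
      · intro p hp q hq r hr hpβ _ hpq hqr
        obtain ⟨-, i, hi⟩ := hM1 p hp
        obtain ⟨-, j, hj⟩ := hM1 q hq
        obtain ⟨-, k, hk⟩ := hM1 r hr
        have hji := hM2 p hp q hq hpq i j hi hj
        have hkj := hM2 q hq r hr hqr j k hj hk
        exact hC3 i j hji k (hkj.trans hji) _ hi _ hj _ hk ((ih p.2 hpβ p.1).1 q hpq).1
      · intro η b ν hαη hηβ hbβ hνβ hcof
        have hti : t (idx (η, b, ν)) = (η, b, ν) :=
          hidx.leftInvOn_invFunOn (show (η, b, ν) ∈ Iio β ×ˢ (Iio β ×ˢ Iio β) from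
            ⟨hηβ, hbβ, hνβ⟩)
        have h4 := hC4 (idx (η, b, ν))
        have h5 := hM4 (idx (η, b, ν))
        simp only [hti] at h4 h5
        obtain ⟨ζ, hζ, hζ'⟩ := h4 hαη hηβ hcof
        exact ⟨ζ, hζ, fun c h1 h2 h3 => h5 hbβ c (hζ' c h1 h2 h3)⟩)
  refine ⟨fun α β => N β α, fun α β => (hN β α).1, fun α β p hp q hq => ?_,
    fun α β p hp q hq r hr => ?_, fun α β => (hN β α).2.2.2.2⟩
  · exact (hN β α).2.1 p hp q hq ((hN β α).1 p hp).2.2.1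
  · exact (hN β α).2.2.1 p hp q hq r hr ((hN β α).1 p hp).2.2.1 ((hN β α).1 q hq).2.2.1

/-! ### The graph -/

/-- A relation on the pairs below `κ⁺` that has no four points each related to all the later ones,
and that meets every union of `κ` many large subsets of columns. -/
theorem exists_graph {κ : Cardinal.{u}} (hκ : κ.IsRegular)
    (hd : Order.succ κ = dominatingNumber κ) :
    ∃ E : Below (Order.succ κ) × Below (Order.succ κ) →
        Below (Order.succ κ) × Below (Order.succ κ) → Prop,
      (∀ p q, E p q → p.1 < q.1) ∧
      (∀ x y a b, E x y → E x a → E x b → E y a → E y b → E a b → False) ∧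
      ∀ (c : Below κ → Below (Order.succ κ)) (B : Below κ → Set (Below (Order.succ κ))),
        StrictMono c → (∀ ξ, Order.succ κ ≤ #(B ξ)) →
        ∃ ξ ξ', ∃ δ ∈ B ξ, ∃ δ' ∈ B ξ', E (c ξ, δ) (c ξ', δ') := by
  classical
  obtain ⟨ρ, ρ1, ρ2, ρ3⟩ := exists_rho hκ
  obtain ⟨G, hG⟩ := exists_dominating hκ hd
  have hne : Nonempty (Below κ) := by
    rw [Ordinal.nonempty_toType_iff]; simpa using hκ.pos.ne'
  obtain ⟨e₀⟩ := hne
  obtain ⟨N, N1, N2, N3, N4⟩ := exists_neighbours hκ ρ3 G e₀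
  refine ⟨fun p q => q ∈ N p.1 p.2, fun p q h => (N1 _ _ q h).1, ?_, ?_⟩
  · intro x y a b hxy hxa hxb hya hyb hab
    -- The neighbourhood of x gives ρ(a, b) < ρ(y, a) for the columns, while that of y, together
    -- with both ultrametric inequalities, gives ρ(y, a) ≤ ρ(a, b).
    have h1 := N3 _ _ y hxy a hxa b hxb hya hab
    have h2 := N2 _ _ a hya b hyb hab
    obtain ⟨h3, h4, -, h5⟩ := N1 _ _ a hya
    have hab' := (N1 _ _ b hab).1
    have h6 := ρ1 a.1 b.1 y.2 hab' (N1 _ _ b hyb).2.1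
    have h7 := ρ2 y.1 a.1 y.2 h3 h4
    have h8 : ρ a.1 y.2 ≤ ρ a.1 b.1 := (le_max_iff.1 h6).resolve_right h2.not_ge
    exact absurd h1 (h7.trans (max_le (h5.le.trans h8) h8)).not_gt
  · intro c B hc hB
    have hsucc := isRegular_succ hκ.aleph0_le
    have hlt : κ < Order.succ κ := Order.lt_succ κ
    -- the supremum of the columns
    obtain ⟨η, hη, hηmin⟩ : ∃ η, (∀ ξ, c ξ < η) ∧ ∀ ζ < η, ∃ ξ, ζ ≤ c ξ := by
      obtain ⟨b, hb⟩ := exists_gt_of_mk_lt hsucc (range c)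
        ((mk_range_le.trans (mk_ord_toType κ).le).trans_lt hlt)
      obtain ⟨η, hη, hmin⟩ := (wellFounded_lt (α := Below (Order.succ κ))).has_min
        {η | ∀ ξ, c ξ < η} ⟨b, fun ξ => hb _ ⟨ξ, rfl⟩⟩
      refine ⟨η, hη, fun ζ hζ => ?_⟩
      by_contra! h
      exact hmin ζ h hζ
    have hcof : ∀ W : Set (Below (Order.succ κ)), #W < κ → (∀ w ∈ W, w < η) →
        ∃ ζ < η, ∀ w ∈ W, w < ζ := by
      intro W hW hWη
      have : Nonempty (Below κ) := ⟨e₀⟩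
      choose! ξ hξ using fun w (hw : w ∈ W) => hηmin w (hWη w hw)
      obtain ⟨m, hm⟩ := exists_gt_of_mk_lt hκ (ξ '' W) (mk_image_le.trans_lt hW)
      exact ⟨c m, hη m, fun w hw => (hξ w hw).trans_lt (hc (hm _ ⟨w, hw, rfl⟩))⟩
    -- a bound below which all the sets have `κ` many elements
    obtain ⟨b, hηb, hb⟩ : ∃ b, η < b ∧ ∀ ξ, κ ≤ #(B ξ ∩ Iio b : Set _) := by
      have h1 : ∀ ξ, ∃ T ⊆ B ξ, #T = κ := fun ξ => by
        have := le_mk_iff_exists_subset.1 (hlt.le.trans (hB ξ))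
        exact this
      choose T hTB hT using h1
      obtain ⟨b, hb⟩ := exists_gt_of_mk_lt hsucc ((⋃ ξ ∈ Set.univ, T ξ) ∪ {η})
        (mk_union_lt hsucc (mk_biUnion_lt hsucc (by simp) fun ξ _ => by
          rw [hT]; exact hlt) (by simpa using hsucc.nat_lt 1))
      refine ⟨b, hb η (Or.inr rfl), fun ξ => ?_⟩
      refine (hT ξ).ge.trans (mk_le_mk_of_subset fun x hx => ⟨hTB ξ hx, hb x (Or.inl ?_)⟩)
      simp only [mem_iUnion]
      exact ⟨ξ, trivial, hx⟩
    have hcol : ∀ ζ, ∃ e, ζ < η → ∃ ξ, ζ ≤ c ξ ∧ ρ (c ξ) η ≤ e := by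
      intro ζ
      by_cases h : ζ < η
      · obtain ⟨ξ, hξ⟩ := hηmin ζ h
        exact ⟨_, fun _ => ⟨ξ, hξ, le_rfl⟩⟩
      · exact ⟨e₀, fun h' => absurd h' h⟩
    choose h hh using hcol
    have hpt : ∀ γ ε, ∃ e, ∀ ξ, c ξ = γ → ∃ δ ∈ B ξ, δ < b ∧ ε < ρ δ b ∧ ρ δ b ≤ e := by
      intro γ ε
      by_cases hγ : ∃ ξ, c ξ = γ
      · obtain ⟨ξ, rfl⟩ := hγ
        obtain ⟨δ, hδ, hδε⟩ : ∃ δ ∈ B ξ ∩ Iio b, ε < ρ δ b := by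
          by_contra! hcon
          have hsub : B ξ ∩ Iio b ⊆ {a | a < b ∧ ρ a b ≤ ε} := fun δ hδ => ⟨hδ.2, hcon δ hδ⟩
          exact absurd ((mk_le_mk_of_subset hsub).trans_lt (ρ3 b ε)) (hb ξ).not_gt
        refine ⟨ρ δ b, fun ξ' hξ' => ?_⟩
        obtain rfl := hc.injective hξ'
        exact ⟨δ, hδ.1, hδ.2, hδε, le_rfl⟩
      · exact ⟨e₀, fun ξ hξ => absurd ⟨ξ, hξ⟩ hγ⟩
    choose g hg using hpt
    -- One ν dominates both requirements; the bound `h`, which does not depend on ε, is later read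
    -- off at ε = `e₀`.
    obtain ⟨ν, hν⟩ := hG b fun γ ε => max (h γ) (g γ ε)
    -- a point of one of the sets high enough to see the task
    obtain ⟨β, hβB, hβ⟩ : ∃ β ∈ B e₀, max b ν < β := by
      by_contra! hcon
      have h1 : #(B e₀) ≤ #(Iic (max b ν)) := mk_le_mk_of_subset fun x hx => hcon x hx
      exact absurd ((hB e₀).trans h1) (mk_Iic_lt hsucc _).not_ge
    have hbβ := (le_max_left b ν).trans_lt hβ
    obtain ⟨ζ, hζ, hζ'⟩ := N4 (c e₀) β η b ν (hη e₀) (hηb.trans hbβ) hbβ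
      ((le_max_right b ν).trans_lt hβ) hcof
    obtain ⟨ξ, hξ, hξe⟩ := hh ζ hζ
    obtain ⟨ε, hε⟩ := hζ' (c ξ) hξ (hη ξ)
      (hξe.trans ((le_max_left _ _).trans (hν ζ (hζ.trans hηb) e₀)))
    obtain ⟨δ, hδB, hδb, hδ1, hδ2⟩ := hg (c ξ) ε ξ rfl
    exact ⟨e₀, ξ, β, hβB, δ, hδB, hε δ hδb hδ1
      (hδ2.trans ((le_max_right _ _).trans (hν (c ξ) ((hη ξ).trans hηb) ε)))⟩

/-! ### Order types and the partition relation -/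

/-- A subset of the lexicographic square of `κ⁺` of order type `κ⁺ * κ` has large intersections
with `κ` many columns. -/
theorem exists_columns_of_strictMono {κ : Cardinal.{u}} (hκ : κ.IsRegular)
    (φ : Below κ ×ₗ Below (Order.succ κ) → Below (Order.succ κ) ×ₗ Below (Order.succ κ))
    (hφ : StrictMono φ) :
    ∃ c : Below κ → Below (Order.succ κ), StrictMono c ∧
      ∀ ξ, Order.succ κ ≤ #{δ | toLex (c ξ, δ) ∈ range φ} := by
  classical
  have hsucc := isRegular_succ hκ.aleph0_le
  have hnext : ∀ ξ : Below κ, ∃ ξ', ξ < ξ' := fun ξ => by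
    obtain ⟨m, hm⟩ := exists_gt_of_mk_lt hκ {ξ} (by simpa using hκ.nat_lt 1)
    exact ⟨m, hm ξ rfl⟩
  have hneL : Nonempty (Below (Order.succ κ)) := by
    rw [Ordinal.nonempty_toType_iff]; simp
  obtain ⟨o⟩ := hneL
  have hmono : ∀ x y, x < y → (ofLex (φ x)).1 ≤ (ofLex (φ y)).1 := by
    intro x y hxy
    rcases Prod.Lex.lt_iff.1 (hφ hxy) with h | h
    · exact h.le
    · exact h.1.le
  have hfib : ∀ ξ, ∃ γ, Order.succ κ ≤ #{β | (ofLex (φ (toLex (ξ, β)))).1 = γ} := by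
    intro ξ
    by_contra! hcon
    -- A point of a later copy bounds the columns met by the copy ξ; by regularity of κ⁺, one of
    -- them receives κ⁺ points.
    obtain ⟨ξ', hξ'⟩ := hnext ξ
    set m := (ofLex (φ (toLex (ξ', o)))).1
    have hcover : (Set.univ : Set (Below (Order.succ κ))) ⊆
        ⋃ γ ∈ Iic m, {β | (ofLex (φ (toLex (ξ, β)))).1 = γ} := by
      intro β _
      simp only [mem_iUnion]
      exact ⟨_, hmono (toLex (ξ, β)) (toLex (ξ', o)) (Prod.Lex.lt_iff.2 (Or.inl hξ')), rfl⟩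
    have := (mk_le_mk_of_subset hcover).trans_lt
      (mk_biUnion_lt hsucc (mk_Iic_lt hsucc m) fun γ _ => hcon γ)
    simp at this
  choose c hc using hfib
  have hinj : ∀ ξ, Order.succ κ ≤ #{δ | ∃ β, φ (toLex (ξ, β)) = toLex (c ξ, δ)} := by
    intro ξ
    refine (hc ξ).trans (mk_le_of_injective
      (f := fun β => ⟨(ofLex (φ (toLex (ξ, β.1)))).2, β.1, ?_⟩) ?_)
    · exact ofLex.injective (Prod.ext β.2 rfl)
    · intro β β' h
      have h2 : (ofLex (φ (toLex (ξ, β.1)))).2 = (ofLex (φ (toLex (ξ, β'.1)))).2 :=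
        congrArg Subtype.val h
      have h3 : φ (toLex (ξ, β.1)) = φ (toLex (ξ, β'.1)) :=
        ofLex.injective (Prod.ext (β.2.trans β'.2.symm) h2)
      have h4 := hφ.injective h3
      exact Subtype.ext (congrArg (fun x => (ofLex x).2) h4)
  refine ⟨c, fun ξ ξ' hξ => ?_, fun ξ => (hinj ξ).trans (mk_le_mk_of_subset ?_)⟩
  · have hpos : ∀ ζ, ∃ δ β, φ (toLex (ζ, β)) = toLex (c ζ, δ) := by
      intro ζ
      have : (#{δ | ∃ β, φ (toLex (ζ, β)) = toLex (c ζ, δ)}) ≠ 0 :=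
        (hsucc.pos.trans_le (hinj ζ)).ne'
      obtain ⟨⟨δ, β, h⟩⟩ := mk_ne_zero_iff.1 this
      exact ⟨δ, β, h⟩
    obtain ⟨δ', β', h'⟩ := hpos ξ'
    by_contra! hle
    -- Otherwise one point of the copy ξ' would bound, within a single column, κ⁺ points of the copy
    -- ξ.
    have : {δ | ∃ β, φ (toLex (ξ, β)) = toLex (c ξ, δ)} ⊆ Iio δ' := by
      rintro δ ⟨β, hβ⟩
      have h1 : φ (toLex (ξ, β)) < φ (toLex (ξ', β')) := hφ (Prod.Lex.lt_iff.2 (Or.inl hξ))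
      rw [hβ, h'] at h1
      rcases Prod.Lex.lt_iff.1 h1 with h | h
      · exact absurd h hle.not_gt
      · exact h.2
    exact absurd ((hinj ξ).trans (mk_le_mk_of_subset this)) (mk_Iio_below_lt δ').not_ge
  · rintro δ ⟨β, hβ⟩
    exact ⟨_, hβ⟩

theorem type_below_prodLex (c d : Cardinal.{u}) :
    Ordinal.type (fun x y : Below c ×ₗ Below d => x < y) = d.ord * c.ord := by
  have := Ordinal.type_prod_lex (fun x y : Below d => x < y) (fun x y : Below c => x < y)
  rw [Ordinal.type_toType, Ordinal.type_toType] at this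
  rw [← this]
  rfl

end OrdinalPartition

theorem mainTheorem1 (κ lam : Cardinal.{u}) (hκ : κ.IsRegular)
    (hlam : lam = Order.succ κ) (hd : lam = OrdinalPartition.dominatingNumber κ) :
    ¬ OrdinalPartition.Arrow (lam.ord ^ 2) ![lam.ord * κ.ord, 4] 2 := by
  classical
  subst hlam
  intro harrow
  obtain ⟨E, E1, E2, E3⟩ := OrdinalPartition.exists_graph hκ hd
  obtain ⟨e⟩ : Nonempty ((fun x y : ((Order.succ κ).ord ^ 2).ToType => x < y) ≃r
      (fun x y : OrdinalPartition.Below (Order.succ κ) ×ₗ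
        OrdinalPartition.Below (Order.succ κ) => x < y)) := by
    rw [← Ordinal.type_eq, OrdinalPartition.type_below_prodLex, Ordinal.type_toType, pow_two]
  obtain ⟨i, X, hX, hcol⟩ := harrow fun s =>
    if ∃ x ∈ s.1, ∃ y ∈ s.1, E (ofLex (e x)) (ofLex (e y)) then 1 else 0
  have hpair : ∀ x ∈ X, ∀ y ∈ X, ∀ h : x ≠ y,
      (if ∃ a ∈ ({x, y} : Finset _), ∃ b ∈ ({x, y} : Finset _), E (ofLex (e a)) (ofLex (e b))
        then (1 : Fin 2) else 0) = i := by
    intro x hx y hy h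
    refine hcol ⟨{x, y}, Finset.card_pair h⟩ ?_
    intro z hz
    rcases Finset.mem_insert.1 (Finset.mem_coe.1 hz) with rfl | hz
    · exact hx
    · rwa [Finset.mem_singleton.1 hz]
  have hlt : ∀ x y, x < y ↔ e x < e y := fun x y => (e.map_rel_iff).symm
  fin_cases i
  · have hX' : Ordinal.type (fun x y : OrdinalPartition.Below κ ×ₗ
        OrdinalPartition.Below (Order.succ κ) => x < y) = Ordinal.type (fun x y : X => x < y) := by
      rw [OrdinalPartition.type_below_prodLex, hX]; rfl
    obtain ⟨φ⟩ := Ordinal.type_eq.1 hX'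
    obtain ⟨c, hc, hcB⟩ := OrdinalPartition.exists_columns_of_strictMono hκ
      (fun x => e (φ x)) (fun x y hxy => (hlt _ _).1 (φ.map_rel_iff.2 hxy))
    obtain ⟨ξ, ξ', δ, ⟨x, hx⟩, δ', ⟨y, hy⟩, hE⟩ := E3 c _ hc hcB
    have hE' : E (ofLex (e (φ x))) (ofLex (e (φ y))) := by
      simp only at hx hy
      rw [hx, hy]; exact hE
    have hne : (φ x : ((Order.succ κ).ord ^ 2).ToType) ≠ φ y := by
      intro h
      rw [h] at hE'
      exact lt_irrefl _ (E1 _ _ hE')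
    have := hpair _ (φ x).2 _ (φ y).2 hne
    rw [if_pos ⟨_, by simp, _, by simp, hE'⟩] at this
    simp at this
  · have hX' : Ordinal.lift.{u} (Ordinal.type (fun x y : Fin 4 => x < y)) =
        Ordinal.lift.{0} (Ordinal.type (fun x y : X => x < y)) := by
      rw [hX, Ordinal.type_fintype]; simp
    obtain ⟨φ⟩ := Ordinal.lift_type_eq.1 hX'
    have key : ∀ m n : Fin 4, m < n → E (ofLex (e (φ m))) (ofLex (e (φ n))) := by
      intro m n hmn
      have h1 : φ m < φ n := φ.map_rel_iff.2 hmn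
      have h2 : e (φ m) < e (φ n) := (hlt _ _).1 h1
      -- The colouring forgets the direction of an edge; since edges lead strictly to the right, the
      -- lexicographic order recovers it.
      have h3 : (ofLex (e (φ m))).1 ≤ (ofLex (e (φ n))).1 := by
        rcases Prod.Lex.lt_iff.1 h2 with h | h
        · exact h.le
        · exact h.1.le
      have h4 := hpair _ (φ m).2 _ (φ n).2 (Subtype.coe_injective.ne h1.ne)
      split_ifs at h4 with h5
      · obtain ⟨a, ha, b, hb, hE⟩ := h5
        have h6 := E1 _ _ hE
        simp only [Finset.mem_insert, Finset.mem_singleton] at ha hb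
        rcases ha with rfl | rfl <;> rcases hb with rfl | rfl
        · exact absurd h6 (lt_irrefl _)
        · exact hE
        · exact absurd h6 h3.not_gt
        · exact absurd h6 (lt_irrefl _)
      · simp at h4
    exact E2 _ _ _ _ (key 0 1 (by decide)) (key 0 2 (by decide)) (key 0 3 (by decide))
      (key 1 2 (by decide)) (key 1 3 (by decide)) (key 2 3 (by decide))
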